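/- Let $d\ge 1$, let $\Omega\subset\mathbb R^d$ be an open, connected, bounded set with Lipschitz boundary, and let $K\colon\mathbb R^d\to[0,+\infty)$ be a (Lebesgue) measurable even function such that $$c'_K:=\int_{\mathbb R^d}K(h)\,|h|\,dh<+\infty .$$ For a measurable function $u$ (on $\Omega$ for $J^1_K$, on $\mathbb R^d$ for $J^2_K$ and $J_K$) put $$J_K^1(u,\Omega):=\int_\Omega\int_\Omega K(y-x)|u(y)-u(x)|\,dx\,dy,\qquad J_K^2(u,\Omega):=\int_\Omega\int_{\mathbb R^d\setminus\Omega} K(y-x)|u(y)-u(x)|\,dx\,dy,$$ $$J_K(u,\Omega):=\tfrac12 J_K^1(u,\Omega)+J_K^2(u,\Omega).$$ For an open set $A\subset\mathbb R^d$ and $u\in L^1(A)$ let $$|Du|(A):=\sup\Big\{\int_A u\,\operatorname{div}\varphi\,dx : \varphi\in C_c^\infty(A;\mathbb R^d),\ |\varphi|\le1\Big\}\in[0,+\infty]$$ be the total variation in $A$ of the distributional gradient of $u$, and let $BV(A):=\{u\in L^1(A): |Du|(A)<+\infty\}$. Then: 1. If $\Omega$ is convex and $u\in BV(\Omega)$,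 then $J_K^1(u,\Omega)\le c'_K\,|Du|(\Omega)$. 2. If $u\in C^1(\mathbb R^d)\cap BV(\mathbb R^d)$, then $J_K(u,\Omega)\le c'_K\int_{\mathbb R^d}|\nabla u|\,dx$. 3. If $u\in BV(\mathbb R^d)$, then $J_K(u,\Omega)\le c'_K\,|Du|(\mathbb R^d)$. -/

import Mathlib

open MeasureTheory Set Metric
open scoped ENNReal NNReal ContDiff

noncomputable section

/-- The boundary of `Ω ⊆ ℝ^d` is Lipschitz: near each of its points, `Ω` is, in suitable
orthonormal coordinates, the region strictly below the graph of a Lipschitz function. Here `ν` is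
the vertical unit direction, and `g` is a function of the remaining `d - 1` coordinates, that is,
a function on the orthogonal complement of `ν`. -/
def HasLipschitzBoundary {d : ℕ} (Ω : Set (EuclideanSpace ℝ (Fin d))) : Prop :=
  ∀ x ∈ frontier Ω, ∃ r : ℝ, 0 < r ∧ ∃ ν : EuclideanSpace ℝ (Fin d), ‖ν‖ = 1 ∧
    ∃ g : (Submodule.span ℝ {ν})ᗮ → ℝ, (∃ L : ℝ≥0, LipschitzWith L g) ∧
      ∀ y ∈ ball x r,
        (y ∈ Ω ↔ inner ℝ ν y < g ((Submodule.span ℝ {ν})ᗮ.orthogonalProjectionOnto y))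

/-- Open, connected, bounded sets with Lipschitz boundary. -/
structure IsLipschitzDomain {d : ℕ} (Ω : Set (EuclideanSpace ℝ (Fin d))) : Prop where
  isOpen : IsOpen Ω
  isConnected : IsConnected Ω
  isBounded : Bornology.IsBounded Ω
  lipschitzBoundary : HasLipschitzBoundary Ω

/-- The first moment `∫ K(h) |h| dh` of the kernel. -/
def firstMoment {d : ℕ} (K : EuclideanSpace ℝ (Fin d) → ℝ≥0) : ℝ≥0∞ :=
  ∫⁻ h, (K h : ℝ≥0∞) * ‖h‖ₑ

/-- Lebesgue measurable, even kernels with values in `[0, ∞)` and finite first moment.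
(For the completed Lebesgue measure, Lebesgue measurability is almost everywhere
measurability.) -/
structure IsAdmissibleKernel {d : ℕ} (K : EuclideanSpace ℝ (Fin d) → ℝ≥0) : Prop where
  aemeasurable : AEMeasurable K volume
  even : ∀ h, K (-h) = K h
  firstMoment_ne_top : firstMoment K ≠ ⊤

/-- `∫_Ω ∫_Ω K(y - x) |u(y) - u(x)| dx dy`. -/
def nonlocalEnergy1 {d : ℕ} (K : EuclideanSpace ℝ (Fin d) → ℝ≥0)
    (u : EuclideanSpace ℝ (Fin d) → ℝ) (Ω : Set (EuclideanSpace ℝ (Fin d))) : ℝ≥0∞ :=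
  ∫⁻ y in Ω, ∫⁻ x in Ω, (K (y - x) : ℝ≥0∞) * ‖u y - u x‖ₑ

/-- `∫_Ω ∫_{Ωᶜ} K(y - x) |u(y) - u(x)| dx dy`. -/
def nonlocalEnergy2 {d : ℕ} (K : EuclideanSpace ℝ (Fin d) → ℝ≥0)
    (u : EuclideanSpace ℝ (Fin d) → ℝ) (Ω : Set (EuclideanSpace ℝ (Fin d))) : ℝ≥0∞ :=
  ∫⁻ y in Ω, ∫⁻ x in Ωᶜ, (K (y - x) : ℝ≥0∞) * ‖u y - u x‖ₑ

/-- The nonlocal `K`-energy of `u` in `Ω`. -/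
def nonlocalEnergy {d : ℕ} (K : EuclideanSpace ℝ (Fin d) → ℝ≥0)
    (u : EuclideanSpace ℝ (Fin d) → ℝ) (Ω : Set (EuclideanSpace ℝ (Fin d))) : ℝ≥0∞ :=
  (1 / 2) * nonlocalEnergy1 K u Ω + nonlocalEnergy2 K u Ω

/-- The divergence of a vector field on `ℝ^d`. -/
def divergence {d : ℕ} (φ : EuclideanSpace ℝ (Fin d) → EuclideanSpace ℝ (Fin d))
    (x : EuclideanSpace ℝ (Fin d)) : ℝ :=
  ∑ i, (fderiv ℝ φ x (EuclideanSpace.single i 1)) i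

/-- Smooth vector fields, compactly supported in `Ω`, of Euclidean length at most one. -/
structure IsTestField {d : ℕ} (Ω : Set (EuclideanSpace ℝ (Fin d)))
    (φ : EuclideanSpace ℝ (Fin d) → EuclideanSpace ℝ (Fin d)) : Prop where
  contDiff : ContDiff ℝ ((⊤ : ℕ∞) : ℕ∞ω) φ
  hasCompactSupport : HasCompactSupport φ
  tsupport_subset : tsupport φ ⊆ Ω
  norm_le_one : ∀ x, ‖φ x‖ ≤ 1

/-- The total variation `|Du|(Ω)` in `[0, ∞]` of the distributional gradient of `u` in the open
set `Ω`, i.e. the supremum of `∫_Ω u div φ` over all test fields `φ` (`φ = 0` is one of them, so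
negative values play no role). It is meant for `u` integrable on `Ω` and depends only on `u`
inside `Ω`. -/
def totalVariation {d : ℕ} (u : EuclideanSpace ℝ (Fin d) → ℝ)
    (Ω : Set (EuclideanSpace ℝ (Fin d))) : ℝ≥0∞ :=
  ⨆ (φ : EuclideanSpace ℝ (Fin d) → EuclideanSpace ℝ (Fin d)) (_ : IsTestField Ω φ),
    ENNReal.ofReal (∫ x in Ω, u x * divergence φ x)

/-- `u ∈ BV(Ω)`: `u ∈ L¹(Ω)` and `|Du|(Ω) < ∞`. The values of `u` outside `Ω` are irrelevant. -/
structure IsBV {d : ℕ} (u : EuclideanSpace ℝ (Fin d) → ℝ)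
    (Ω : Set (EuclideanSpace ℝ (Fin d))) : Prop where
  integrableOn : IntegrableOn u Ω volume
  totalVariation_ne_top : totalVariation u Ω ≠ ⊤

end

/-! Substituting `h = y - x` and applying Tonelli turns the energy on `U × U` into `∫ K(h) ∫ |u(x+h)
- u(x)| dx dh`, the inner integral running over `U ∩ (U - h)`. It therefore suffices to bound that
integral by `|h| |Du|(U)` for convex `U` (`lintegral_enorm_translate_sub_le`). No smoothing of `u`
is needed: by duality, test the difference against smooth `ψ` with `|ψ| ≤ 1` and move the
translation onto `ψ`. Then `ψ(x-h) - ψ(x)` is the divergence of `-f h`, where `f(x) = ∫₀¹ ψ(x - th)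
dt`, and `-f h/|h|` is a test field for `|Du|(U)`. For a general `Ω`, enlarge the domain of
integration to the whole space, which is convex. The `C¹` bound then follows from `|Du| ≤ ∫ |∇u|`,
by integration by parts. -/

open scoped Manifold in
/-- A smooth cutoff function that is one on a compact set and supported in an open one. -/
lemma exists_smooth_cutoff {E : Type*} [NormedAddCommGroup E] [NormedSpace ℝ E]
    [FiniteDimensional ℝ E] {A V : Set E} (hA : IsCompact A) (hV : IsOpen V) (hAV : A ⊆ V) :
    ∃ f : E → ℝ, ContDiff ℝ ((⊤ : ℕ∞) : ℕ∞ω) f ∧ HasCompactSupport f ∧ tsupport f ⊆ V ∧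
      (∀ x ∈ A, f x = 1) ∧ ∀ x, f x ∈ Icc (0 : ℝ) 1 := by
  obtain ⟨L, hL, hAL, hLV⟩ := exists_compact_between hA hV hAV
  obtain ⟨f, h1, h0, hf⟩ := exists_contMDiffMap_one_nhds_of_subset_interior (n := ⊤)
    𝓘(ℝ, E) hA.isClosed hAL
  have hs : tsupport f ⊆ L := closure_minimal
    (fun x hx ↦ by_contra fun h ↦ hx (h0 x h)) hL.isClosed
  exact ⟨f, f.contMDiff.contDiff, hL.of_isClosed_subset (isClosed_tsupport _) hs,
    hs.trans hLV, fun x hx ↦ h1.self_of_nhdsSet x hx, hf⟩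

/-- The `L¹` norm on an open set is controlled by duality with smooth test functions. -/
lemma lintegral_enorm_le_of_forall_test {E : Type*} [NormedAddCommGroup E] [NormedSpace ℝ E]
    [FiniteDimensional ℝ E] [MeasurableSpace E] [BorelSpace E] {μ : Measure E}
    {V : Set E} (hV : IsOpen V) {w : E → ℝ} (hw : IntegrableOn w V μ) {C : ℝ≥0∞}
    (h : ∀ ψ : E → ℝ, ContDiff ℝ ∞ ψ → HasCompactSupport ψ → tsupport ψ ⊆ V →
      (∀ x, |ψ x| ≤ 1) → ENNReal.ofReal (∫ x in V, w x * ψ x ∂μ) ≤ C) :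
    ∫⁻ x in V, ‖w x‖ₑ ∂μ ≤ C := by
  wlog hm : StronglyMeasurable w generalizing w
  · have hae := hw.1.ae_eq_mk
    have hae' : (fun x ↦ ‖w x‖ₑ) =ᵐ[μ.restrict V] fun x ↦ ‖hw.1.mk w x‖ₑ :=
      hae.fun_comp (‖·‖ₑ)
    rw [lintegral_congr_ae hae']
    refine this (hw.congr hae) (fun ψ h1 h2 h3 h4 ↦ ?_) hw.1.stronglyMeasurable_mk
    refine le_of_eq_of_le (congrArg _ (integral_congr_ae ?_)) (h ψ h1 h2 h3 h4)
    filter_upwards [hae] with x hx using by rw [hx]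
  have hmeas := hm.measurable
  -- Inner regularity of the finite measure `|w| μ` makes the `|w|`-mass lost outside compact sets
  -- small.
  set ν := (μ.restrict V).withDensity fun x ↦ ‖w x‖ₑ with hν
  have : IsFiniteMeasure ν := isFiniteMeasure_withDensity hw.2.ne
  refine ENNReal.le_of_forall_pos_le_add fun ε hε _ ↦ ?_
  have hε4 : (ε / 4 : ℝ≥0∞) ≠ 0 := by simp [hε.ne']
  set A := V ∩ {x | 0 < w x} with hA
  set B := V ∩ {x | w x < 0} with hB
  have hAm : MeasurableSet A := hV.measurableSet.inter (measurableSet_lt measurable_const hmeas)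
  have hBm : MeasurableSet B := hV.measurableSet.inter (measurableSet_lt hmeas measurable_const)
  obtain ⟨A', hA'A, hA'c, hA'⟩ := hAm.exists_isCompact_sdiff_lt (measure_ne_top ν A) hε4
  obtain ⟨B', hB'B, hB'c, hB'⟩ := hBm.exists_isCompact_sdiff_lt (measure_ne_top ν B) hε4
  have hAB : ∀ x ∈ A', x ∉ B' := fun x h1 h2 ↦
    lt_asymm (show 0 < w x from (hA'A h1).2) (show w x < 0 from (hB'B h2).2)
  -- Each cutoff is supported away from the other compact set, so `f - g` equals the sign of `w` on
  -- `A' ∪ B'`.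
  obtain ⟨f, hf, hfc, hfV, hf1, hf01⟩ := exists_smooth_cutoff hA'c
    (hV.inter hB'c.isClosed.isOpen_compl) fun x hx ↦ ⟨(hA'A hx).1, hAB x hx⟩
  obtain ⟨g, hg, hgc, hgV, hg1, hg01⟩ := exists_smooth_cutoff hB'c
    (hV.inter hA'c.isClosed.isOpen_compl) fun x hx ↦ ⟨(hB'B hx).1, fun h ↦ hAB x h hx⟩
  have hf0 : ∀ x ∈ B', f x = 0 := fun x hx ↦ by_contra fun h ↦
    (hfV (subset_tsupport f h)).2 hx
  have hg0 : ∀ x ∈ A', g x = 0 := fun x hx ↦ by_contra fun h ↦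
    (hgV (subset_tsupport g h)).2 hx
  set ψ : E → ℝ := fun x ↦ f x - g x with hψ
  have hψ1 : ∀ x, |ψ x| ≤ 1 := fun x ↦ by
    have h1 := hf01 x
    have h2 := hg01 x
    rw [abs_le]
    constructor <;> simp only [hψ] <;> linarith [h1.1, h1.2, h2.1, h2.2]
  have hψs : ContDiff ℝ ∞ ψ := hf.sub hg
  have hψc : HasCompactSupport ψ := hfc.sub hgc
  have hψV : tsupport ψ ⊆ V := (tsupport_sub f g).trans
    (union_subset (hfV.trans inter_subset_left) (hgV.trans inter_subset_left))
  have hint : IntegrableOn (fun x ↦ w x * ψ x) V μ :=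
    hw.mul_bdd (c := 1) hψs.continuous.aestronglyMeasurable (.of_forall hψ1)
  have hle : ∀ x, w x * ψ x ≤ |w x| := fun x ↦ by
    calc w x * ψ x ≤ |w x * ψ x| := le_abs_self _
      _ = |w x| * |ψ x| := abs_mul _ _
      _ ≤ |w x| * 1 := by gcongr; exact hψ1 x
      _ = |w x| := mul_one _
  have hge : ∀ x, -|w x| ≤ w x * ψ x := fun x ↦ by
    calc -|w x| = -(|w x| * 1) := by rw [mul_one]
      _ ≤ -(|w x| * |ψ x|) := by gcongr; exact hψ1 x
      _ = -|w x * ψ x| := by rw [abs_mul]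
      _ ≤ _ := neg_abs_le _
  have hD : MeasurableSet ((A \ A') ∪ (B \ B')) :=
    (hAm.diff hA'c.measurableSet).union (hBm.diff hB'c.measurableSet)
  calc ∫⁻ x in V, ‖w x‖ₑ ∂μ = ENNReal.ofReal (∫ x in V, |w x| ∂μ) := by
        rw [← ofReal_integral_norm_eq_lintegral_enorm hw]; rfl
    _ = ENNReal.ofReal ((∫ x in V, w x * ψ x ∂μ) + ∫ x in V, (|w x| - w x * ψ x) ∂μ) := by
        rw [integral_sub hw.abs hint]; ring_nf
    _ ≤ ENNReal.ofReal (∫ x in V, w x * ψ x ∂μ)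
        + ENNReal.ofReal (∫ x in V, (|w x| - w x * ψ x) ∂μ) := ENNReal.ofReal_add_le
    _ ≤ C + ∫⁻ x in V, ENNReal.ofReal (|w x| - w x * ψ x) ∂μ := by
        refine add_le_add (h ψ hψs hψc hψV hψ1) ?_
        exact (ofReal_integral_eq_lintegral_ofReal (hw.abs.sub hint)
          (.of_forall fun x ↦ sub_nonneg.2 (hle x))).le
    -- The defect `|w| - wψ` vanishes on `A' ∪ B'` and where `w = 0`; elsewhere it is at most
    -- `2|w|`.
    _ ≤ C + ∫⁻ x in V, 2 * ((A \ A') ∪ (B \ B')).indicator (fun x ↦ ‖w x‖ₑ) x ∂μ := by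
        gcongr C + ?_
        refine setLIntegral_mono_ae' hV.measurableSet (.of_forall fun x hx ↦ ?_)
        by_cases hxD : x ∈ (A \ A') ∪ (B \ B')
        · rw [indicator_of_mem hxD, Real.enorm_eq_ofReal_abs,
            show (2 : ℝ≥0∞) = ENNReal.ofReal 2 by simp, ← ENNReal.ofReal_mul zero_le_two]
          exact ENNReal.ofReal_le_ofReal (by linarith [hge x])
        · rw [indicator_of_notMem hxD, mul_zero, nonpos_iff_eq_zero, ENNReal.ofReal_eq_zero]
          simp only [mem_union, mem_sdiff, not_or, not_and, not_not] at hxD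
          rcases lt_trichotomy (w x) 0 with h0 | h0 | h0
          · have hxB := hxD.2 ⟨hx, h0⟩
            simp [hψ, hf0 x hxB, hg1 x hxB, abs_of_neg h0]
          · simp [h0]
          · have hxA := hxD.1 ⟨hx, h0⟩
            simp [hψ, hg0 x hxA, hf1 x hxA, abs_of_pos h0]
    _ = C + 2 * ν ((A \ A') ∪ (B \ B')) := by
        rw [lintegral_const_mul _ (hmeas.enorm.indicator hD), lintegral_indicator hD,
          hν, withDensity_apply _ hD]
    _ ≤ C + 2 * (ε / 4 + ε / 4) := by
        gcongr
        exact (measure_union_le _ _).trans (add_le_add hA'.le hB'.le)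
    _ = C + ε := by
        congr 1
        have h2 : (ε : ℝ≥0∞) = ((ε : ℝ≥0) : ℝ≥0∞) := rfl
        rw [show (ε / 4 : ℝ≥0∞) = ((ε / 4 : ℝ≥0) : ℝ≥0∞) by
          rw [ENNReal.coe_div (by norm_num)]; rfl]
        norm_cast
        ring

/-- The average of a smooth function along translates in a segment. -/
lemma exists_segment_average {E : Type*} [NormedAddCommGroup E] [NormedSpace ℝ E]
    [FiniteDimensional ℝ E] {U : Set E} (hU : Convex ℝ U) {ψ : E → ℝ} {h : E}
    (hψ : ContDiff ℝ ∞ ψ) (hψc : HasCompactSupport ψ) (hψU : tsupport ψ ⊆ U)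
    (hψh : ∀ x ∈ tsupport ψ, x + h ∈ U) (hψ1 : ∀ x, |ψ x| ≤ 1) :
    ∃ f : E → ℝ, ContDiff ℝ ∞ f ∧ HasCompactSupport f ∧ tsupport f ⊆ U ∧ (∀ x, |f x| ≤ 1) ∧
      ∀ x, fderiv ℝ f x h = ψ x - ψ (x - h) := by
  borelize E
  -- With `m` uniform on the segment from `0` to `h`, `f` is a convolution and inherits the
  -- smoothness of `ψ`.
  set m : Measure E := (volume.restrict (Icc (0 : ℝ) 1)).map fun t ↦ t • h with hm
  have hmeas : Measurable fun t : ℝ ↦ t • h := by fun_prop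
  have : IsFiniteMeasure m := Measure.isFiniteMeasure_map _ _
  have hloc : LocallyIntegrable (fun _ : E ↦ (1 : ℝ)) m := (integrable_const _).locallyIntegrable
  set L := ContinuousLinearMap.mul ℝ ℝ with hL
  set f : E → ℝ := convolution (fun _ : E ↦ (1 : ℝ)) ψ L m with hf
  have hfx : ∀ x, f x = ∫ t in Icc (0 : ℝ) 1, ψ (x - t • h) := fun x ↦ by
    simp only [hf, convolution, hL, ContinuousLinearMap.mul_apply', one_mul]
    rw [hm, integral_map hmeas.aemeasurable]
    exact (hψ.continuous.comp (by fun_prop)).aestronglyMeasurable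
  set S : Set E := (fun p : ℝ × E ↦ p.2 + p.1 • h) '' (Icc (0 : ℝ) 1 ×ˢ tsupport ψ) with hS
  have hSc : IsCompact S := (isCompact_Icc.prod hψc).image (by fun_prop)
  have hfS : tsupport f ⊆ S := by
    refine closure_minimal (fun x hx ↦ by_contra fun hxS ↦ hx ?_) hSc.isClosed
    rw [hfx, setIntegral_eq_zero_of_forall_eq_zero]
    intro t ht
    by_contra hne
    exact hxS ⟨(t, x - t • h), ⟨ht, subset_tsupport ψ hne⟩, by simp⟩
  -- Convexity enters here: `x` and `x + h` lie in `U`, hence so does the segment between them.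
  have hSU : S ⊆ U := by
    rintro _ ⟨⟨t, x⟩, ⟨ht, hx⟩, rfl⟩
    exact hU.add_smul_mem (hψU hx) (hψh x hx) ht
  refine ⟨f, hψc.contDiff_convolution_right L hloc hψ,
    hSc.of_isClosed_subset (isClosed_tsupport _) hfS, hfS.trans hSU, fun x ↦ ?_, fun x ↦ ?_⟩
  · rw [hfx, ← Real.norm_eq_abs]
    refine (norm_setIntegral_le_of_norm_le_const (C := 1) (by simp) fun t _ ↦ hψ1 _).trans ?_
    simp
  · have hfd : DifferentiableAt ℝ f x :=
      (hψc.contDiff_convolution_right L hloc hψ).differentiable (by simp) x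
    have hq : Continuous fun r : ℝ ↦ ψ (x + r • h) := hψ.continuous.comp (by fun_prop)
    -- On the line through `x`, `f` is a sliding average over `[s - 1, s]`; its derivative is the
    -- difference of the endpoint values.
    have hline : ∀ s : ℝ, f (x + s • h) =
        (∫ r in (0 : ℝ)..s, ψ (x + r • h)) - ∫ r in (0 : ℝ)..(s - 1), ψ (x + r • h) := fun s ↦ by
      rw [intervalIntegral.integral_interval_sub_left (hq.intervalIntegrable _ _)
        (hq.intervalIntegrable _ _), hfx, integral_Icc_eq_integral_Ioc,
        ← intervalIntegral.integral_of_le zero_le_one]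
      have := intervalIntegral.integral_comp_sub_left (a := 0) (b := 1)
        (fun r : ℝ ↦ ψ (x + r • h)) s
      rw [sub_zero] at this
      rw [← this]
      congr 1 with t
      rw [sub_smul, add_sub_assoc]
    have hFTC : ∀ s : ℝ, HasDerivAt (fun s ↦ ∫ r in (0 : ℝ)..s, ψ (x + r • h))
        (ψ (x + s • h)) s := fun s ↦ intervalIntegral.integral_hasDerivAt_right
      (hq.intervalIntegrable _ _) hq.stronglyMeasurable.stronglyMeasurableAtFilter hq.continuousAt
    have h1 : HasDerivAt (fun s : ℝ ↦ f (x + s • h)) (ψ x - ψ (x - h)) 0 := by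
      simp only [hline]
      have h2 : HasDerivAt (fun s ↦ (∫ r in (0 : ℝ)..s, ψ (x + r • h))
          - ∫ r in (0 : ℝ)..(s - 1), ψ (x + r • h))
          (ψ (x + (0 : ℝ) • h) - ψ (x + (0 - 1 : ℝ) • h)) 0 :=
        (hFTC 0).sub ((hFTC (0 - 1)).comp_sub_const 0 1)
      rwa [zero_smul, add_zero, zero_sub, neg_one_smul, ← sub_eq_add_neg] at h2
    have h3 : HasDerivAt (fun s : ℝ ↦ f (x + s • h)) (fderiv ℝ f x h) 0 :=
      hfd.hasFDerivAt.hasLineDerivAt h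
    exact h3.unique h1

lemma divergence_smul_const {d : ℕ} {f : EuclideanSpace ℝ (Fin d) → ℝ}
    {x : EuclideanSpace ℝ (Fin d)} (hf : DifferentiableAt ℝ f x) (v : EuclideanSpace ℝ (Fin d)) :
    divergence (fun x ↦ f x • v) x = fderiv ℝ f x v := by
  have hv : v = ∑ i, v i • EuclideanSpace.single i (1 : ℝ) := by
    ext j
    simp [Finset.sum_apply, Pi.single_apply]
  conv_rhs => rw [hv, map_sum]
  refine Finset.sum_congr rfl fun i _ ↦ ?_
  rw [fderiv_smul_const hf]
  simp [mul_comm]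

/-- On a convex open set, difference quotients in `L¹` are controlled by the total variation. -/
lemma lintegral_enorm_translate_sub_le {d : ℕ} {U : Set (EuclideanSpace ℝ (Fin d))}
    (hUo : IsOpen U) (hU : Convex ℝ U) {u : EuclideanSpace ℝ (Fin d) → ℝ}
    (hu : IntegrableOn u U) (h : EuclideanSpace ℝ (Fin d)) :
    ∫⁻ x in U ∩ (· + h) ⁻¹' U, ‖u (x + h) - u x‖ₑ ≤ ‖h‖ₑ * totalVariation u U := by
  rcases eq_or_ne h 0 with rfl | hh
  · simp
  have hVo : IsOpen (U ∩ (· + h) ⁻¹' U) := hUo.inter (hUo.preimage (by fun_prop))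
  set V := U ∩ (· + h) ⁻¹' U with hV
  -- Extension by zero permits translation-invariant integration over the whole space and changes
  -- nothing on `V`.
  set u' := U.indicator u with hu'
  have hi : Integrable u' := hu.integrable_indicator hUo.measurableSet
  have hih : Integrable fun x ↦ u' (x + h) := hi.comp_add_right h
  have heq : EqOn (fun x ↦ u (x + h) - u x) (fun x ↦ u' (x + h) - u' x) V := fun x hx ↦ by
    have h2 : x + h ∈ U := hx.2
    simp [hu', hx.1, h2]
  refine lintegral_enorm_le_of_forall_test hVo
    ((hih.sub hi).integrableOn.congr_fun heq.symm hVo.measurableSet) fun ψ hψ hψc hψV hψ1 ↦ ?_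
  obtain ⟨f, hf, hfc, hfU, hf1, hfd⟩ := exists_segment_average (h := h) hU hψ hψc
    (hψV.trans inter_subset_left) (fun x hx ↦ (hψV hx).2) hψ1
  have hn : ‖h‖ ≠ 0 := norm_ne_zero_iff.2 hh
  set φ : EuclideanSpace ℝ (Fin d) → EuclideanSpace ℝ (Fin d) :=
    fun x ↦ f x • (-(‖h‖⁻¹ • h)) with hφ
  have hφs : tsupport φ ⊆ tsupport f := tsupport_smul_subset_left f _
  have hφt : IsTestField U φ :=
    { contDiff := hf.smul contDiff_const
      hasCompactSupport := hfc.smul_right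
      tsupport_subset := hφs.trans hfU
      norm_le_one := fun x ↦ by
        rw [hφ]
        simp only [norm_smul, norm_neg, norm_inv, norm_norm, inv_mul_cancel₀ hn, mul_one]
        exact hf1 x }
  have hdiv : ∀ x, ‖h‖ * divergence φ x = ψ (x - h) - ψ x := fun x ↦ by
    rw [hφ, divergence_smul_const (hf.differentiable (by simp) x), map_neg, map_smul, hfd]
    simp only [smul_eq_mul]
    field_simp
    ring
  have hb : ∀ {v : EuclideanSpace ℝ (Fin d) → ℝ}, Integrable v →
      Integrable fun x ↦ v x * ψ x := fun hv ↦
    hv.mul_bdd (c := 1) hψ.continuous.aestronglyMeasurable (.of_forall hψ1)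
  have hbh : Integrable fun x ↦ u' x * ψ (x - h) :=
    hi.mul_bdd (c := 1) (hψ.continuous.comp (by fun_prop)).aestronglyMeasurable
      (.of_forall fun x ↦ hψ1 (x - h))
  have key : ∫ x in V, (u (x + h) - u x) * ψ x = ‖h‖ * ∫ x in U, u x * divergence φ x := by
    calc ∫ x in V, (u (x + h) - u x) * ψ x = ∫ x in V, (u' (x + h) - u' x) * ψ x :=
          setIntegral_congr_fun hVo.measurableSet fun x hx ↦ congrArg (· * ψ x) (heq hx)
      _ = ∫ x, (u' (x + h) - u' x) * ψ x := by
          refine setIntegral_eq_integral_of_forall_compl_eq_zero fun x hx ↦ ?_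
          rw [image_eq_zero_of_notMem_tsupport fun h' ↦ hx (hψV h'), mul_zero]
      _ = (∫ x, u' (x + h) * ψ x) - ∫ x, u' x * ψ x := by
          rw [← integral_sub (hb hih) (hb hi)]
          simp only [sub_mul]
      _ = (∫ x, u' x * ψ (x - h)) - ∫ x, u' x * ψ x := by
          congr 1
          rw [← integral_add_right_eq_self (fun x ↦ u' x * ψ (x - h)) h]
          simp only [add_sub_cancel_right]
      _ = ∫ x, U.indicator (fun x ↦ u x * (‖h‖ * divergence φ x)) x := by
          rw [← integral_sub hbh (hb hi)]
          congr 1 with x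
          rw [← mul_sub, ← hdiv]
          exact (indicator_mul_left U u fun x ↦ ‖h‖ * divergence φ x).symm
      _ = ‖h‖ * ∫ x in U, u x * divergence φ x := by
          rw [integral_indicator hUo.measurableSet, ← integral_const_mul]
          congr 1 with x
          ring
  rw [key, ENNReal.ofReal_mul (norm_nonneg h), ofReal_norm]
  gcongr
  exact le_iSup₂_of_le φ hφt le_rfl

/-- Tonelli in the variables `y` and `h = y - x`, then the difference quotient bound for each `h`.
-/
lemma nonlocalEnergy1_le {d : ℕ} {U : Set (EuclideanSpace ℝ (Fin d))}
    (hUo : IsOpen U) (hU : Convex ℝ U) {K : EuclideanSpace ℝ (Fin d) → ℝ≥0}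
    (hK : AEMeasurable K) {u : EuclideanSpace ℝ (Fin d) → ℝ} (hu : IntegrableOn u U) :
    nonlocalEnergy1 K u U ≤ firstMoment K * totalVariation u U := by
  let E := EuclideanSpace ℝ (Fin d)
  have hUm := hUo.measurableSet
  set u' : E → ℝ := U.indicator u with hu'
  have hi : AEMeasurable u' := (hu.integrable_indicator hUm).aemeasurable
  set I : E → ℝ≥0∞ := U.indicator 1 with hI
  have hIm : Measurable I := measurable_one.indicator hUm
  set G : E → E → ℝ≥0∞ := fun y x ↦ I y * I x * ‖u' y - u' x‖ₑ with hG
  have hGU : ∀ {y x}, y ∈ U → x ∈ U → G y x = ‖u y - u x‖ₑ := fun hy hx ↦ by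
    simp [hG, hI, hu', hy, hx]
  have hfirst : nonlocalEnergy1 K u U = ∫⁻ y, ∫⁻ x, (K (y - x) : ℝ≥0∞) * G y x := by
    rw [nonlocalEnergy1, ← lintegral_indicator hUm]
    congr 1 with y
    by_cases hy : y ∈ U
    · rw [indicator_of_mem hy, ← lintegral_indicator hUm]
      congr 1 with x
      by_cases hx : x ∈ U
      · rw [indicator_of_mem hx, hGU hy hx]
      · simp [hx, hG, hI]
    · simp [hy, hG, hI]
  -- As `u'` is only a.e. measurable, composing it with subtraction requires preimages of null sets
  -- to be null.
  have hq : Measure.QuasiMeasurePreserving (fun p : E × E ↦ p.1 - p.2)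
      (volume.prod volume) volume := quasiMeasurePreserving_sub volume volume
  have hmeas : AEMeasurable (fun p : E × E ↦ (K p.2 : ℝ≥0∞) * G p.1 (p.1 - p.2))
      (volume.prod volume) := by
    have h1 : AEMeasurable (fun p : E × E ↦ u' (p.1 - p.2)) (volume.prod volume) :=
      hi.comp_quasiMeasurePreserving hq
    have h2 : AEMeasurable (fun p : E × E ↦ u' p.1) (volume.prod volume) :=
      hi.comp_quasiMeasurePreserving Measure.quasiMeasurePreserving_fst
    have h3 : AEMeasurable (fun p : E × E ↦ K p.2) (volume.prod volume) :=
      hK.comp_quasiMeasurePreserving Measure.quasiMeasurePreserving_snd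
    have h4 : Measurable fun p : E × E ↦ I p.1 * I (p.1 - p.2) :=
      (hIm.comp measurable_fst).mul (hIm.comp (measurable_fst.sub measurable_snd))
    exact h3.coe_nnreal_ennreal.mul (h4.aemeasurable.mul (h2.sub h1).enorm)
  calc nonlocalEnergy1 K u U = ∫⁻ y, ∫⁻ h, (K h : ℝ≥0∞) * G y (y - h) := by
        rw [hfirst]
        congr 1 with y
        rw [← lintegral_sub_left_eq_self _ y]
        simp
    _ = ∫⁻ h, ∫⁻ y, (K h : ℝ≥0∞) * G y (y - h) := lintegral_lintegral_swap hmeas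
    _ ≤ ∫⁻ h, (K h : ℝ≥0∞) * ‖h‖ₑ * totalVariation u U := by
        refine lintegral_mono fun h ↦ ?_
        rw [lintegral_const_mul' _ _ ENNReal.coe_ne_top, mul_assoc]
        gcongr
        refine le_of_eq_of_le ?_ (lintegral_enorm_translate_sub_le hUo hU hu h)
        have hVm : MeasurableSet (U ∩ (· + h) ⁻¹' U) := hUm.inter (hUm.preimage (by fun_prop))
        rw [← lintegral_add_right_eq_self _ h, ← lintegral_indicator hVm]
        congr 1 with x
        rw [add_sub_cancel_right]
        by_cases hx : x ∈ U ∩ (· + h) ⁻¹' U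
        · rw [indicator_of_mem hx, hGU hx.2 hx.1]
        · rw [indicator_of_notMem hx]
          by_cases hxU : x ∈ U
          · have : x + h ∉ U := fun h' ↦ hx ⟨hxU, h'⟩
            simp [hG, hI, this]
          · simp [hG, hI, hxU]
    _ = firstMoment K * totalVariation u U :=
        lintegral_mul_const'' _ (hK.coe_nnreal_ennreal.mul measurable_enorm.aemeasurable)

lemma nonlocalEnergy_le_nonlocalEnergy1_univ {d : ℕ} {Ω : Set (EuclideanSpace ℝ (Fin d))}
    (hΩ : MeasurableSet Ω) (K : EuclideanSpace ℝ (Fin d) → ℝ≥0)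
    (u : EuclideanSpace ℝ (Fin d) → ℝ) :
    nonlocalEnergy K u Ω ≤ nonlocalEnergy1 K u univ := by
  calc nonlocalEnergy K u Ω ≤ nonlocalEnergy1 K u Ω + nonlocalEnergy2 K u Ω := by
        refine add_le_add_left (mul_le_of_le_one_left' ?_) _
        simp
    -- Superadditivity of the lower integral needs no measurability.
    _ ≤ ∫⁻ y in Ω, ((∫⁻ x in Ω, (K (y - x) : ℝ≥0∞) * ‖u y - u x‖ₑ)
          + ∫⁻ x in Ωᶜ, (K (y - x) : ℝ≥0∞) * ‖u y - u x‖ₑ) := le_lintegral_add _ _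
    _ = ∫⁻ y in Ω, ∫⁻ x, (K (y - x) : ℝ≥0∞) * ‖u y - u x‖ₑ := by
        simp only [lintegral_add_compl _ hΩ]
    _ ≤ nonlocalEnergy1 K u univ := by
        simp only [nonlocalEnergy1, Measure.restrict_univ]
        exact setLIntegral_le_lintegral _ _

/-- The total variation of a `C¹` function is at most the integral of the length of its
gradient. -/
lemma totalVariation_univ_le_lintegral_gradient {d : ℕ} {u : EuclideanSpace ℝ (Fin d) → ℝ}
    (hu : ContDiff ℝ 1 u) :
    totalVariation u univ ≤ ∫⁻ x, ‖gradient u x‖ₑ := by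
  refine iSup₂_le fun φ hφ ↦ ?_
  have hφd : Differentiable ℝ φ := hφ.contDiff.differentiable (by simp)
  set e : Fin d → EuclideanSpace ℝ (Fin d) := fun i ↦ EuclideanSpace.single i 1 with he
  have hcomp : ∀ i, ContDiff ℝ ∞ fun x ↦ φ x i := fun i ↦
    (EuclideanSpace.proj (𝕜 := ℝ) i).contDiff.comp hφ.contDiff
  have hcs : ∀ i, HasCompactSupport fun x ↦ φ x i := fun i ↦
    hφ.hasCompactSupport.comp_left (g := fun v : EuclideanSpace ℝ (Fin d) ↦ v i) rfl
  have hdcs : ∀ i, HasCompactSupport fun x ↦ fderiv ℝ (fun x ↦ φ x i) x (e i) := fun i ↦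
    (hcs i).fderiv_apply ℝ _
  have hdc : ∀ i, Continuous fun x ↦ fderiv ℝ (fun x ↦ φ x i) x (e i) := fun i ↦
    ((hcomp i).continuous_fderiv (by simp)).clm_apply continuous_const
  have huc : Continuous u := hu.continuous
  have hud : ∀ v, Continuous fun x ↦ fderiv ℝ u x v := fun v ↦
    (hu.continuous_fderiv (by simp)).clm_apply continuous_const
  have hdiv : ∀ x, divergence φ x = ∑ i, fderiv ℝ (fun x ↦ φ x i) x (e i) := fun x ↦ by
    refine Finset.sum_congr rfl fun i _ ↦ ?_
    have := ((EuclideanSpace.proj (𝕜 := ℝ) i).hasFDerivAt.comp x (hφd x).hasFDerivAt).fderiv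
    exact (congrArg (fun L : _ →L[ℝ] ℝ ↦ L (e i)) this).symm
  have hi1 : ∀ i, Integrable fun x ↦ u x * fderiv ℝ (fun x ↦ φ x i) x (e i) := fun i ↦
    (huc.mul (hdc i)).integrable_of_hasCompactSupport (hdcs i).mul_left
  have hi2 : ∀ i, Integrable fun x ↦ fderiv ℝ u x (e i) * φ x i := fun i ↦
    ((hud _).mul (hcomp i).continuous).integrable_of_hasCompactSupport (hcs i).mul_left
  have hi3 : ∀ i, Integrable fun x ↦ u x * φ x i := fun i ↦
    (huc.mul (hcomp i).continuous).integrable_of_hasCompactSupport (hcs i).mul_left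
  have hsum : ∀ x, ∑ i, fderiv ℝ u x (e i) * φ x i = inner ℝ (gradient u x) (φ x) := fun x ↦ by
    have hv : φ x = ∑ i, φ x i • e i := by
      ext j
      simp [he, Finset.sum_apply, Pi.single_apply]
    rw [gradient, InnerProductSpace.toDual_symm_apply]
    conv_rhs => rw [hv, map_sum]
    exact Finset.sum_congr rfl fun i _ ↦ by rw [map_smul, smul_eq_mul, mul_comm]
  have key : ∫ x in univ, u x * divergence φ x = ∫ x, -inner ℝ (gradient u x) (φ x) := by
    rw [Measure.restrict_univ]
    simp only [hdiv, Finset.mul_sum, ← hsum]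
    rw [integral_finsetSum _ fun i _ ↦ hi1 i, integral_neg, integral_finsetSum _ fun i _ ↦ hi2 i,
      ← Finset.sum_neg_distrib]
    -- The compact support of `φ` supplies all the integrability, so there is no boundary term.
    exact Finset.sum_congr rfl fun i _ ↦ integral_mul_fderiv_eq_neg_fderiv_mul_of_integrable
      (hi2 i) (hi1 i) (hi3 i) (fun x _ ↦ hu.differentiable (by simp) x)
      (fun x _ ↦ (hcomp i).differentiable (by simp) x)
  rw [key]
  refine (ENNReal.ofReal_le_ofReal (le_abs_self _)).trans ?_
  rw [← Real.enorm_eq_ofReal_abs]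
  refine (enorm_integral_le_lintegral_enorm _).trans (lintegral_mono fun x ↦ ?_)
  rw [enorm_neg, ← ofReal_norm, ← ofReal_norm]
  refine ENNReal.ofReal_le_ofReal ((norm_inner_le_norm _ _).trans ?_)
  exact mul_le_of_le_one_right (norm_nonneg _) (hφ.norm_le_one x)

theorem mainTheorem11 (d : ℕ) (hd : 1 ≤ d)
    (Ω : Set (EuclideanSpace ℝ (Fin d))) (hΩ : IsLipschitzDomain Ω)
    (K : EuclideanSpace ℝ (Fin d) → ℝ≥0) (hK : IsAdmissibleKernel K) :
    (Convex ℝ Ω → ∀ u : EuclideanSpace ℝ (Fin d) → ℝ, IsBV u Ω →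
      nonlocalEnergy1 K u Ω ≤ firstMoment K * totalVariation u Ω) ∧
    (∀ u : EuclideanSpace ℝ (Fin d) → ℝ, ContDiff ℝ 1 u → IsBV u univ →
      nonlocalEnergy K u Ω ≤ firstMoment K * ∫⁻ x, ‖gradient u x‖ₑ) ∧
    (∀ u : EuclideanSpace ℝ (Fin d) → ℝ, IsBV u univ →
      nonlocalEnergy K u Ω ≤ firstMoment K * totalVariation u univ) := by
  have hglobal : ∀ u : EuclideanSpace ℝ (Fin d) → ℝ, IsBV u univ →
      nonlocalEnergy K u Ω ≤ firstMoment K * totalVariation u univ := fun u hu ↦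
    (nonlocalEnergy_le_nonlocalEnergy1_univ hΩ.isOpen.measurableSet K u).trans
      (nonlocalEnergy1_le isOpen_univ convex_univ hK.aemeasurable hu.integrableOn)
  refine ⟨fun hconv u hu ↦
    nonlocalEnergy1_le hΩ.isOpen hconv hK.aemeasurable hu.integrableOn,
    fun u hu hBV ↦ (hglobal u hBV).trans ?_, hglobal⟩
  gcongr
  exact totalVariation_univ_le_lintegral_gradient hu
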